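/- Let $A$ be a unital $C^*$-algebra and let $H$ be a Hilbert $A$-module, that is, an $A$-module with a positive definite $A$-valued inner product $\langle\cdot,\cdot\rangle$, complete in the norm $\|x\|=\|\langle x,x\rangle\|^{1/2}$. For Hilbert $A$-modules $H_1,H_2$ let $B(H_1,H_2)$ be the set of all bounded $A$-module maps $H_1\to H_2$ (they need not have adjoints), and for an integer $n\ge 1$ let $A^{(n)}$ be the Hilbert $A$-module that is the orthogonal direct sum of $n$ copies of $A$. Suppose that there are an integer $n\ge 1$ and a surjective map $S\in B(A^{(n)},H)$. Then $H$ is projective in the category of Hilbert $A$-modules with bounded module maps as morphisms, that is: (1) for every Hilbert $A$-module $H_1$ and every surjective $\varphi\in B(H_1,H)$ there is $\psi\in B(H,H_1)$ with $\varphi\circ\psi=\mathrm{id}_H$; (2) for all Hilbert $A$-modules $H_1,H_2$, every surjective $\varphi\in B(H_1,H_2)$ and every $\psi\in B(H,H_2)$ there is $\chi\in B(H,H_1)$ with $\varphi\circ\chi=\psi$. (All modules are taken on the same side of $A$; since $A$ is arbitrary, the statements for left and for right modules are equivalent, by passing to the opposite algebra.) -/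

import Mathlib

open scoped WithCStarModule

universe u v w₁ w₂

/-- A Hilbert module over the unital C⋆-algebra `A` is a complete `CStarModule A H`: an `A`-module
with a positive definite `A`-valued inner product, complete for the norm `‖x‖ = ‖⟪x, x⟫‖ ^ (1 / 2)`.
Mathlib writes the action on the left, with `⟪x, a • y⟫ = a * ⟪x, y⟫`; right modules over a
C⋆-algebra are the same thing over the opposite C⋆-algebra. The space `B(H₁, H₂)` of bounded module
maps, which need not have adjoints, is `H₁ →L[A] H₂`.

`H` is projective, with bounded module maps as morphisms, if every bounded module map from another
Hilbert module onto `H` has a bounded module map as right inverse, and every bounded module map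
from `H` lifts through every surjective bounded module map of Hilbert modules. -/
structure IsProjectiveHilbertModule (A : Type u) [CStarAlgebra A] [PartialOrder A]
    [StarOrderedRing A] (H : Type v) [NormedAddCommGroup H] [NormedSpace ℂ H] [Module A H]
    [CStarModule A H] [CompleteSpace H] : Prop where
  exists_rightInverse : ∀ (H₁ : Type w₁) [NormedAddCommGroup H₁] [NormedSpace ℂ H₁] [Module A H₁]
    [CStarModule A H₁] [CompleteSpace H₁] (φ : H₁ →L[A] H), Function.Surjective φ →
      ∃ ψ : H →L[A] H₁, φ.comp ψ = ContinuousLinearMap.id A H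
  exists_lift : ∀ (H₁ : Type w₁) [NormedAddCommGroup H₁] [NormedSpace ℂ H₁] [Module A H₁]
    [CStarModule A H₁] [CompleteSpace H₁]
    (H₂ : Type w₂) [NormedAddCommGroup H₂] [NormedSpace ℂ H₂] [Module A H₂]
    [CStarModule A H₂] [CompleteSpace H₂]
    (φ : H₁ →L[A] H₂), Function.Surjective φ → ∀ ψ : H →L[A] H₂,
      ∃ χ : H →L[A] H₁, φ.comp χ = ψ

open Function

namespace ContinuousLinearMap

/-! A bounded module map `S` on `A^n` has the form `a ↦ ∑ aᵢ xᵢ`, so it is automatically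
adjointable, with adjoint `T y = (⟪xᵢ, y⟫)ᵢ`. If `S` is onto, the open mapping theorem makes `T`
bounded below, hence `S T` is invertible and `T (S T)⁻¹` is a right inverse `R` of `S`. Maps out of
the free module `A^n` lift by lifting the images of the basis; composing such lifts with `R` settles
both claims for `H` (`eq_piLift`, `isUnit_comp_adjoint`, `exists_lift`). -/

/-- A bounded operator is invertible if all its translates by nonnegative scalars are bounded below
by the same positive constant: invertibility passes from the translates by large scalars down to
the operator itself, in steps of fixed length. -/
theorem isUnit_of_antilipschitz_add_smul {E : Type*} [NormedAddCommGroup E] [NormedSpace ℂ E]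
    [CompleteSpace E] (P : E →L[ℂ] E) {c : ℝ} (hc : 0 < c)
    (h : ∀ t : ℝ, 0 ≤ t → ∀ y, c * ‖y‖ ≤ ‖P y + (t : ℂ) • y‖) : IsUnit P := by
  have step : ∀ t : ℝ, 0 ≤ t →
      IsUnit (P + ((t + c / 2 : ℝ) : ℂ) • (1 : E →L[ℂ] E)) →
        IsUnit (P + (t : ℂ) • (1 : E →L[ℂ] E)) := by
    rintro t ht ⟨U, hU⟩
    -- The lower bound gives an inverse of norm at most `c⁻¹` at every `t`, so a step of `c / 2`
    -- always stays within the Neumann series.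
    have hnorm : ‖((c / 2 : ℝ) : ℂ) • (↑U⁻¹ : E →L[ℂ] E)‖ < 1 := by
      have hle : ‖(↑U⁻¹ : E →L[ℂ] E)‖ ≤ c⁻¹ := by
        refine ContinuousLinearMap.opNorm_le_bound _ (by positivity) fun y => ?_
        have hb := h (t + c / 2) (by positivity) ((↑U⁻¹ : E →L[ℂ] E) y)
        have hy : (U : E →L[ℂ] E) ((↑U⁻¹ : E →L[ℂ] E) y) = y := by
          rw [← mul_apply_eq_comp, Units.mul_inv, one_apply_eq_self]
        rw [hU] at hy
        simp only [add_apply, smul_apply, one_apply_eq_self] at hy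
        rw [hy] at hb
        rwa [inv_mul_eq_div, le_div_iff₀' hc]
      rw [norm_smul, Complex.norm_real, Real.norm_of_nonneg (by positivity)]
      calc c / 2 * ‖(↑U⁻¹ : E →L[ℂ] E)‖ ≤ c / 2 * c⁻¹ := by gcongr
        _ < 1 := by field_simp; norm_num
    have hfac : P + (t : ℂ) • (1 : E →L[ℂ] E)
        = U * (1 - ((c / 2 : ℝ) : ℂ) • (↑U⁻¹ : E →L[ℂ] E)) := by
      rw [mul_sub, mul_one, mul_smul_comm, Units.mul_inv, hU, Complex.ofReal_add, add_smul]
      abel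
    rw [hfac]
    exact U.isUnit.mul (isUnit_one_sub_of_norm_lt_one hnorm)
  have descend : ∀ k : ℕ,
      IsUnit (P + ((k * (c / 2) : ℝ) : ℂ) • (1 : E →L[ℂ] E)) → IsUnit P := by
    intro k
    induction k with
    | zero => simp
    | succ k ih =>
      intro hk
      refine ih (step _ (by positivity) ?_)
      convert hk using 4
      push_cast
      ring
  obtain ⟨k, hk⟩ := exists_nat_gt (‖P‖ / (c / 2))
  rw [div_lt_iff₀ (by positivity)] at hk
  set t : ℝ := k * (c / 2)
  have htpos : 0 < t := (norm_nonneg P).trans_lt hk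
  have ht0 : (t : ℂ) ≠ 0 := by exact_mod_cast htpos.ne'
  refine descend k ?_
  have hfac : P + (t : ℂ) • (1 : E →L[ℂ] E) = (t : ℂ) • (1 - (-(t : ℂ)⁻¹) • P) := by
    rw [smul_sub, smul_smul, mul_neg, mul_inv_cancel₀ ht0]
    simp [add_comm]
  rw [hfac]
  refine (isUnit_one_sub_of_norm_lt_one ?_).smul (Units.mk0 (t : ℂ) ht0)
  rw [norm_smul, norm_neg, norm_inv, Complex.norm_real, Real.norm_of_nonneg htpos.le,
    inv_mul_eq_div, div_lt_one htpos]
  exact hk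

end ContinuousLinearMap

namespace CStarModule

section

variable {A : Type*} [CStarAlgebra A] [PartialOrder A]
  {E : Type*} [NormedAddCommGroup E] [NormedSpace ℂ E] [Module A E] [CStarModule A E]

local notation "⟪" x ", " y "⟫" => inner A x y

variable (A) in
theorem ext_inner_left {x y : E} (h : ∀ z : E, ⟪z, x⟫ = ⟪z, y⟫) : x = y := by
  rw [← sub_eq_zero, ← inner_self (A := A), inner_sub_right, h, sub_self]

variable (A E) in
/-- The actions of `ℂ` and of `A` on a Hilbert module are compatible. -/
theorem isScalarTower : IsScalarTower ℂ A E where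
  smul_assoc z a x := ext_inner_left A fun y => by
    rw [inner_op_smul_right, inner_smul_right_complex, inner_op_smul_right, smul_mul_assoc]

variable [StarOrderedRing A]
  {F : Type*} [NormedAddCommGroup F] [NormedSpace ℂ F] [Module A F] [CStarModule A F]

/-- If `S` is a surjective adjointable operator of Hilbert modules with adjoint `T`, then `S ∘ T`
is invertible. -/
theorem isUnit_comp_adjoint [CompleteSpace E] [CompleteSpace F] (S : E →L[ℂ] F) (T : F →L[ℂ] E)
    (adj : ∀ x y, ⟪S x, y⟫ = ⟪x, T y⟫) (hS : Surjective S) : IsUnit (S.comp T) := by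
  obtain ⟨C, hC, hpre⟩ := S.exists_preimage_norm_le hS
  -- Pair `y = S x` with itself, where `‖x‖ ≤ C * ‖y‖`, and move `S` across.
  have hT : ∀ y, ‖y‖ ≤ C * ‖T y‖ := by
    intro y
    obtain ⟨x, rfl, hx⟩ := hpre y
    rcases (norm_nonneg (S x)).eq_or_lt with h0 | h0
    · rw [← h0]; positivity
    refine le_of_mul_le_mul_left ?_ h0
    calc ‖S x‖ * ‖S x‖ = ‖⟪x, T (S x)⟫‖ := by rw [← adj, ← norm_sq_eq A, sq]
      _ ≤ ‖x‖ * ‖T (S x)‖ := norm_inner_le E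
      _ ≤ C * ‖S x‖ * ‖T (S x)‖ := by gcongr
      _ = ‖S x‖ * (C * ‖T (S x)‖) := by ring
  refine ContinuousLinearMap.isUnit_of_antilipschitz_add_smul _ (c := (C ^ 2)⁻¹) (by positivity)
    fun t ht y => ?_
  rcases (norm_nonneg y).eq_or_lt with h0 | h0
  · rw [← h0, mul_zero]; positivity
  refine le_of_mul_le_mul_left ?_ h0
  -- The translate adds a positive element to `⟪T y, T y⟫`, which cannot lower the norm; hence the
  -- bound is uniform in `t`.
  have hinner : ⟪S (T y) + (t : ℂ) • y, y⟫ = ⟪T y, T y⟫ + t • ⟪y, y⟫ := by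
    rw [inner_add_left, adj, inner_smul_left_complex]
    simp
  calc ‖y‖ * ((C ^ 2)⁻¹ * ‖y‖) = (C ^ 2)⁻¹ * ‖y‖ ^ 2 := by ring
    _ ≤ (C ^ 2)⁻¹ * (C * ‖T y‖) ^ 2 := by gcongr; exact hT y
    _ = ‖T y‖ ^ 2 := by field_simp
    _ = ‖⟪T y, T y⟫‖ := norm_sq_eq A
    _ ≤ ‖⟪S (T y) + (t : ℂ) • y, y⟫‖ := by
      rw [hinner]
      exact CStarAlgebra.norm_le_norm_of_nonneg_of_le inner_self_nonneg
        (le_add_of_nonneg_right (smul_nonneg ht inner_self_nonneg))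
    _ ≤ ‖S (T y) + (t : ℂ) • y‖ * ‖y‖ := norm_inner_le F
    _ = ‖y‖ * ‖S.comp T y + (t : ℂ) • y‖ := mul_comm _ _

/-- A surjective adjointable module map of Hilbert modules has a bounded module map as right
inverse. -/
theorem exists_rightInverse_of_adjoint [CompleteSpace E] [CompleteSpace F] (S : E →L[A] F)
    (T : F →L[A] E) (adj : ∀ x y, ⟪S x, y⟫ = ⟪x, T y⟫) (hS : Surjective S) :
    ∃ R : F →L[A] E, S.comp R = ContinuousLinearMap.id A F := by
  have := isScalarTower A E
  have := isScalarTower A F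
  obtain ⟨U, hU⟩ := isUnit_comp_adjoint (S.restrictScalars ℂ) (T.restrictScalars ℂ) adj hS
  have hU_apply : ∀ y, (U : F →L[ℂ] F) y = S (T y) := fun y => by rw [hU]; rfl
  have hright : ∀ y, S (T ((↑U⁻¹ : F →L[ℂ] F) y)) = y := fun y => by
    rw [← hU_apply, ← mul_apply_eq_comp, Units.mul_inv,
      one_apply_eq_self]
  have hleft : ∀ y, (↑U⁻¹ : F →L[ℂ] F) (S (T y)) = y := fun y => by
    rw [← hU_apply, ← mul_apply_eq_comp, Units.inv_mul,
      one_apply_eq_self]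
  let V : F →L[A] F :=
    { toFun := (↑U⁻¹ : F →L[ℂ] F)
      map_add' := map_add _
      map_smul' := fun a y => by
        -- The inverse was found over `ℂ` only; it is `A`-linear because `S T` is.
        conv_lhs => rw [← hright y, ← map_smul, ← map_smul, hleft]
        rfl
      cont := (↑U⁻¹ : F →L[ℂ] F).continuous }
  exact ⟨T.comp V, ContinuousLinearMap.ext hright⟩

end

end CStarModule

namespace WithCStarModule

variable {A : Type*} [CStarAlgebra A] [PartialOrder A]
  {ι : Type*} [Fintype ι]
  {H : Type*} [NormedAddCommGroup H] [NormedSpace ℂ H] [Module A H] [CStarModule A H]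

theorem continuous_smul_right (x : H) : Continuous fun a : A => a • x := by
  have := CStarModule.isScalarTower A H
  let f : A →ₗ[ℂ] H :=
    { toFun := fun a => a • x
      map_add' := fun a b => add_smul a b x
      map_smul' := fun z a => smul_assoc z a x }
  refine AddMonoidHomClass.continuous_of_bound f ‖x‖ fun a => ?_
  refine abs_le_of_sq_le_sq' ?_ (by positivity) |>.2
  calc ‖a • x‖ ^ 2 = ‖a * (inner A x x * star a)‖ := by
        rw [CStarModule.norm_sq_eq A, CStarModule.inner_op_smul_right,
          CStarModule.inner_op_smul_left]
    _ ≤ ‖a‖ * (‖inner A x x‖ * ‖star a‖) :=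
        (norm_mul_le _ _).trans (by gcongr; exact norm_mul_le _ _)
    _ = (‖x‖ * ‖a‖) ^ 2 := by rw [norm_star, ← CStarModule.norm_sq_eq A]; ring

/-- The bounded module map from `A^ι` that sends the standard basis to the family `x`. -/
noncomputable def piLift (x : ι → H) : C⋆ᵐᵒᵈ(A, ι → A) →L[A] H :=
  { toFun := fun a => ∑ i, a i • x i
    map_add' := fun a b => by simp [add_smul, Finset.sum_add_distrib]
    map_smul' := fun r a => by simp [Finset.smul_sum, mul_smul]
    cont := by
      refine continuous_finsetSum _ fun i _ => (continuous_smul_right (x i)).comp ?_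
      exact (continuous_apply i).comp uniformEquiv.continuous }

theorem piLift_apply (x : ι → H) (a : C⋆ᵐᵒᵈ(A, ι → A)) : piLift x a = ∑ i, a i • x i := rfl

/-- This is what supplies an adjoint for an arbitrary bounded module map on `A^ι`. -/
theorem eq_piLift [DecidableEq ι] (S : C⋆ᵐᵒᵈ(A, ι → A) →L[A] H) :
    S = piLift fun i => S ((equiv A (ι → A)).symm (Pi.single i 1)) := by
  ext a
  rw [piLift_apply]
  simp_rw [← map_smul, ← map_sum]
  congr 1
  exact pi_eq_sum_univ' (equiv A (ι → A) a)

/-- The Hilbert module `A^ι` is projective. -/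
theorem exists_lift {K : Type*} [NormedAddCommGroup K] [NormedSpace ℂ K] [Module A K]
    [CStarModule A K] (φ : H →L[A] K) (hφ : Surjective φ) (ψ : C⋆ᵐᵒᵈ(A, ι → A) →L[A] K) :
    ∃ χ : C⋆ᵐᵒᵈ(A, ι → A) →L[A] H, φ.comp χ = ψ := by
  classical
  choose x hx using fun i => hφ (ψ ((equiv A (ι → A)).symm (Pi.single i 1)))
  refine ⟨piLift x, ?_⟩
  rw [eq_piLift ψ]
  ext a
  simp [piLift_apply, hx]

variable [StarOrderedRing A]

/-- The adjoint of `piLift`. -/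
noncomputable def piLiftAdjoint (x : ι → H) : H →L[A] C⋆ᵐᵒᵈ(A, ι → A) :=
  { toFun := fun y => (equiv A (ι → A)).symm fun i => inner A (x i) y
    map_add' := fun y z => by ext i; simp
    map_smul' := fun r y => by ext i; simp
    cont := by
      refine uniformEquiv.symm.continuous.comp (continuous_pi fun i => ?_)
      exact CStarModule.continuous_inner.comp (continuous_const.prodMk continuous_id) }

theorem inner_piLift_left (x : ι → H) (a : C⋆ᵐᵒᵈ(A, ι → A)) (y : H) :
    inner A (piLift x a) y = inner A a (piLiftAdjoint x y) := by
  rw [piLift_apply, CStarModule.inner_sum_left, pi_inner]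
  exact Finset.sum_congr rfl fun i _ => CStarModule.inner_op_smul_left

end WithCStarModule

/-- `C⋆ᵐᵒᵈ(A, Fin n → A)` is the Hilbert module `A^(n)`, the orthogonal direct sum of `n` copies
of `A`. -/
theorem corollary3p9 {A : Type u} [CStarAlgebra A] [PartialOrder A] [StarOrderedRing A]
    {H : Type v} [NormedAddCommGroup H] [NormedSpace ℂ H] [Module A H] [CStarModule A H]
    [CompleteSpace H] (n : ℕ) (hn : 1 ≤ n)
    (S : C⋆ᵐᵒᵈ(A, Fin n → A) →L[A] H) (hS : Function.Surjective S) :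
    IsProjectiveHilbertModule.{u, v, w₁, w₂} A H := by
  obtain ⟨R, hR⟩ : ∃ R : H →L[A] C⋆ᵐᵒᵈ(A, Fin n → A),
      S.comp R = ContinuousLinearMap.id A H := by
    rw [WithCStarModule.eq_piLift S] at hS ⊢
    exact CStarModule.exists_rightInverse_of_adjoint _ _ (WithCStarModule.inner_piLift_left _) hS
  constructor
  · intro H₁ _ _ _ _ _ φ hφ
    obtain ⟨χ, hχ⟩ := WithCStarModule.exists_lift φ hφ S
    exact ⟨χ.comp R, by rw [← ContinuousLinearMap.comp_assoc, hχ, hR]⟩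
  · intro H₁ _ _ _ _ _ H₂ _ _ _ _ _ φ hφ ψ
    obtain ⟨χ, hχ⟩ := WithCStarModule.exists_lift φ hφ (ψ.comp S)
    refine ⟨χ.comp R, ?_⟩
    rw [← ContinuousLinearMap.comp_assoc, hχ, ContinuousLinearMap.comp_assoc, hR,
      ContinuousLinearMap.comp_id]
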